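/- Let $\gamma\in(0,2]$ and let $Z$ be a real random variable with characteristic function $E\{\exp(itZ)\}=\exp(-|t|^\gamma/2)$ for all $t\in\mathbb{R}$. For $a\in\mathbb{R}$ and $b>0$, let $\mathcal{S}(a,b)$ denote the probability distribution of $a+b^{1/\gamma}Z$. Fix real numbers $0=u_0<u_1<u_2<\dots<u$ (so $u_n<u$ for every $n$). Define $f_0=0$ and, for $n\ge 0$, $x\in\mathbb{R}^n$ and $y\in\mathbb{R}$, $$f_{n+1}(x,y)=f_n(x)\left(1-c_n^{1/\gamma}\right)+y\,c_n^{1/\gamma},\qquad c_n=\frac{u_{n+1}-u_n}{u-u_n},$$ and set $\sigma_n(x)=\mathcal{S}\bigl(f_n(x),\,u-u_n\bigr)$ for $n\ge 0$ and $x\in\mathbb{R}^n$. Let $X_1,X_2,\dots$ be the coordinate random variables on $\mathbb{R}^\infty$, and let $P_\sigma$ be the unique Borel probability measure on $\mathbb{R}^\infty$ under which $X_1$ has distribution $\sigma_0$ and, for each $n\ge 1$, $\sigma_n(x)$ is the conditional distribution of $X_{n+1}$ given $(X_1,\dots,X_n)=x$. Then $P_\sigma$ is conditionally identically distributed (c.i.d.):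 with $\mathcal{G}_n=\sigma(X_1,\dots,X_n)$ ($\mathcal{G}_0$ trivial), for all $k>n\ge 0$ and every Borel set $A\subset\mathbb{R}$, $$P_\sigma\bigl(X_k\in A\mid\mathcal{G}_n\bigr)=P_\sigma\bigl(X_{n+1}\in A\mid\mathcal{G}_n\bigr)\quad P_\sigma\text{-a.s.}$$ -/

import Mathlib

open MeasureTheory ProbabilityTheory

/-- A strategy on a measurable space `S`: for each `n`, a measurable family `σ_n(x)`, `x ∈ S ^ n`,
of probability measures on `S`. Since `S ^ 0` is a one-point space, `σ_0` is a single probability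
measure. -/
structure Strategy (S : Type*) [MeasurableSpace S] where
  /-- The `n`-th predictive `x ↦ σ_n(x)`. -/
  pred : (n : ℕ) → Kernel (Fin n → S) S
  /-- Each `σ_n(x)` is a probability measure. -/
  markov : ∀ n, IsMarkovKernel (pred n)

namespace Strategy

variable {S : Type*} [MeasurableSpace S]

instance (σ : Strategy S) (n : ℕ) : IsMarkovKernel (σ.pred n) := σ.markov n

/-- Sequences in `S ^ ∞` are indexed by `ℕ`, so the random variable `X_{i+1}` is the coordinate
`x ↦ x i`. This is the predictive `σ_{n+1}`, as a kernel on the coordinates `0, ..., n`. -/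
noncomputable def stepKernel (σ : Strategy S) (n : ℕ) :
    Kernel ((i : Finset.Iic n) → (fun _ : ℕ => S) i) S :=
  (σ.pred (n + 1)).comap
    (fun x (i : Fin (n + 1)) => x ⟨i, Finset.mem_Iic.2 (Nat.lt_succ_iff.1 i.isLt)⟩)
    (measurable_pi_lambda _ fun _ => measurable_pi_apply _)

instance (σ : Strategy S) (n : ℕ) : IsMarkovKernel (σ.stepKernel n) := by
  unfold stepKernel; infer_instance

/-- The probability measure `P_σ` on `S ^ ∞` under which `X_1` has distribution `σ_0` and `σ_n(x)`
is the conditional distribution of `X_{n+1}` given `(X_1, ..., X_n) = x`, from the Ionescu-Tulcea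
theorem. -/
noncomputable def law (σ : Strategy S) : Measure (ℕ → S) :=
  Kernel.trajMeasure (X := fun _ => S) (σ.pred 0 Fin.elim0) σ.stepKernel

instance (σ : Strategy S) : IsProbabilityMeasure σ.law := by
  unfold law; infer_instance

end Strategy

/-- The `σ`-algebra generated by the first `n` coordinates `X_1, ..., X_n` on `S ^ ∞`, trivial for
`n = 0`. -/
abbrev pastSigma (S : Type*) [MeasurableSpace S] (n : ℕ) : MeasurableSpace (ℕ → S) :=
  MeasurableSpace.comap (fun (x : ℕ → S) (i : Fin n) => x i) inferInstance

/-- `P` is conditionally identically distributed: for all `k > n ≥ 0`,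
`P(X_k ∈ · | X_1, ..., X_n) = P(X_{n+1} ∈ · | X_1, ..., X_n)` almost surely. With `X_{i+1}` the
coordinate `x ↦ x i`, the index `k - 1 ≥ n` is the one that is quantified over here. -/
def IsCID {S : Type*} [MeasurableSpace S] (P : Measure (ℕ → S)) : Prop :=
  ∀ n k : ℕ, n ≤ k → ∀ A : Set S, MeasurableSet A →
    P⟦(fun x : ℕ → S => x k) ⁻¹' A|pastSigma S n⟧
      =ᵐ[P] P⟦(fun x : ℕ → S => x n) ⁻¹' A|pastSigma S n⟧

namespace StablePrediction

/-- The distribution `S(a, b)` of `a + b ^ (1 / γ) * Z`. -/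
noncomputable def stableLaw {Ω : Type*} [MeasurableSpace Ω] (μ : Measure Ω) (Z : Ω → ℝ)
    (γ a b : ℝ) : Measure ℝ :=
  μ.map (fun ω => a + b ^ (1 / γ) * Z ω)

/-- The recursive locations: `f_0 = 0` and
`f_{n+1}(x, y) = f_n(x) (1 - c ^ (1 / γ)) + y c ^ (1 / γ)`, `c = (u_{n+1} - u_n) / (u - u_n)`. -/
noncomputable def loc (γ u : ℝ) (us : ℕ → ℝ) : (n : ℕ) → (Fin n → ℝ) → ℝ
  | 0, _ => 0
  | n + 1, x =>
      loc γ u us n (fun i : Fin n => x i.castSucc)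
          * (1 - ((us (n + 1) - us n) / (u - us n)) ^ (1 / γ))
        + x (Fin.last n) * ((us (n + 1) - us n) / (u - us n)) ^ (1 / γ)

theorem measurable_loc (γ u : ℝ) (us : ℕ → ℝ) (n : ℕ) : Measurable (loc γ u us n) := by
  induction n with
  | zero => exact measurable_const
  | succ n ih =>
    have h : Measurable fun x : Fin (n + 1) → ℝ => loc γ u us n (fun i : Fin n => x i.castSucc) :=
      ih.comp (measurable_pi_lambda _ fun _ => measurable_pi_apply _)
    exact (h.mul_const _).add ((measurable_pi_apply _).mul_const _)

theorem measurable_stableLaw {Ω : Type*} [MeasurableSpace Ω] (μ : Measure Ω)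
    [IsProbabilityMeasure μ] (Z : Ω → ℝ) (hZ : Measurable Z) (γ b : ℝ) :
    Measurable (fun a => stableLaw μ Z γ a b) := by
  refine Measure.measurable_of_measurable_coe _ fun A hA => ?_
  have h : Measurable fun p : ℝ × Ω => p.1 + b ^ (1 / γ) * Z p.2 := by fun_prop
  have h' : ∀ a, stableLaw μ Z γ a b A =
      μ (Prod.mk a ⁻¹' ((fun p : ℝ × Ω => p.1 + b ^ (1 / γ) * Z p.2) ⁻¹' A)) := fun a =>
    Measure.map_apply (by fun_prop) hA
  simp_rw [h']
  exact measurable_measure_prodMk_left (h hA)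

/-- The strategy `σ_n(x) = S(f_n(x), u - u_n)`. -/
noncomputable def stableStrategy {Ω : Type*} [MeasurableSpace Ω] (μ : Measure Ω)
    [IsProbabilityMeasure μ] (Z : Ω → ℝ) (hZ : Measurable Z) (γ u : ℝ) (us : ℕ → ℝ) :
    Strategy ℝ where
  pred n :=
    { toFun := fun x => stableLaw μ Z γ (loc γ u us n x) (u - us n)
      measurable' :=
        (measurable_stableLaw μ Z hZ γ (u - us n)).comp (measurable_loc γ u us n) }
  markov n := ⟨fun _ => Measure.isProbabilityMeasure_map (by fun_prop)⟩

end StablePrediction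

/-! Everything reduces to a one-step identity: if averaging `σ_{n+1}(x, y)` over `y ~ σ_n(x)`
returns `σ_n(x)`, then `X_{n+2}` and `X_{n+1}` have the same conditional law given the first `n`
coordinates. Iterating, with events of the first `n` coordinates read as events of the first `k`,
gives c.i.d.

For the stable strategy, write `y = f_n + (u - u_n)^(1/γ) Z`. The weight `c_n^(1/γ)` is chosen so
that `f_{n+1}(x, y) = f_n + (u_{n+1} - u_n)^(1/γ) Z`. The average is therefore `S(f_n, u_{n+1} -
u_n) ∗ S(0, u - u_{n+1})`, which stability identifies with `S(f_n, u - u_n)`. -/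

namespace Strategy

/-! ### Consistent predictives and the c.i.d. property -/

variable {S : Type*} [MeasurableSpace S]

/-- The first `n` coordinates of a sequence. -/
abbrev initial (S : Type*) (n : ℕ) (x : ℕ → S) (i : Fin n) : S := x i

theorem measurable_initial (n : ℕ) : Measurable (initial S n) :=
  measurable_pi_lambda _ fun _ => measurable_pi_apply _

/-- Under `P_σ`, the first coordinate has distribution `σ_0`. -/
theorem law_map_eval_zero (σ : Strategy S) :
    σ.law.map (fun x => x 0) = σ.pred 0 Fin.elim0 := by
  have h : (fun x : ℕ → S => x 0) =
      (MeasurableEquiv.piUnique (fun i : Finset.Iic 0 => S)) ∘ Preorder.frestrictLe 0 := by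
    ext x
    rfl
  rw [h, ← Measure.map_map (by fun_prop) (by fun_prop)]
  unfold law Kernel.trajMeasure
  rw [Measure.map_comp _ _ (by fun_prop), Kernel.traj_map_frestrictLe, Kernel.partialTraj_self,
    Measure.id_comp, Measure.map_map (by fun_prop) (by fun_prop)]
  convert Measure.map_id
  ext x
  rfl

/-- Under `P_σ`, the conditional distribution of the `n`-th coordinate given the previous ones
is `σ_n`. -/
theorem law_map_initial_compProd (σ : Strategy S) (n : ℕ) :
    σ.law.map (initial S n) ⊗ₘ σ.pred n = σ.law.map (fun x => (initial S n x, x n)) := by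
  have hm := fun n => measurable_initial (S := S) n
  ext s hs
  rw [Measure.compProd_apply hs, Measure.map_apply (by fun_prop) hs,
    lintegral_map (Kernel.measurable_kernel_prodMk_left hs) (hm n)]
  cases n with
  | zero =>
    have h0 : ∀ x : ℕ → S, initial S 0 x = Fin.elim0 := fun x => Subsingleton.elim _ _
    simp_rw [h0]
    rw [lintegral_const, measure_univ, mul_one, ← law_map_eval_zero,
      Measure.map_apply (by fun_prop) (measurable_prodMk_left hs)]
    rfl
  | succ n =>
    -- `g` reindexes `Finset.Iic n` by `Fin (n + 1)`. Since `stepKernel` is `pred (n + 1)` pulled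
    -- back along `g`, testing the Ionescu-Tulcea identity on the preimage of `s` gives the goal.
    let g : ((i : Finset.Iic n) → (fun _ : ℕ => S) i) → Fin (n + 1) → S :=
      fun x i => x ⟨i, Finset.mem_Iic.2 (Nat.lt_succ_iff.1 i.isLt)⟩
    have hg : Measurable g := measurable_pi_lambda _ fun _ => measurable_pi_apply _
    have hs' : MeasurableSet (Prod.map g id ⁻¹' s) := (hg.prodMap measurable_id) hs
    have key := congrArg (fun ν => ν (Prod.map g id ⁻¹' s))
      (Kernel.map_frestrictLe_trajMeasure_compProd_eq_map_trajMeasure (X := fun _ => S)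
        (μ₀ := σ.pred 0 Fin.elim0) (κ := σ.stepKernel) (a := n))
    rw [Measure.compProd_apply hs', Measure.map_apply (by fun_prop) hs',
      lintegral_map (Kernel.measurable_kernel_prodMk_left hs') (by fun_prop)] at key
    exact key

theorem lintegral_initial_eval (σ : Strategy S) (n : ℕ) {f : (Fin n → S) × S → ENNReal}
    (hf : Measurable f) :
    ∫⁻ x, f (initial S n x, x n) ∂σ.law
      = ∫⁻ x, ∫⁻ y, f (initial S n x, y) ∂σ.pred n (initial S n x) ∂σ.law := by
  have hm := measurable_initial (S := S) n
  rw [← lintegral_map (μ := σ.law) (g := fun x => (initial S n x, x n)) hf (by fun_prop),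
    ← law_map_initial_compProd, Measure.lintegral_compProd hf,
    lintegral_map hf.lintegral_kernel_prod_right' hm]

/-- The predictives of `σ` are consistent: averaging `σ_{n+1}` over its last argument with respect
to `σ_n` gives back `σ_n`. -/
def IsConsistent (σ : Strategy S) : Prop :=
  ∀ (n : ℕ) (x : Fin n → S) (A : Set S), MeasurableSet A →
    ∫⁻ y, σ.pred (n + 1) (Fin.snoc (α := fun _ => S) x y) A ∂σ.pred n x = σ.pred n x A

theorem law_initial_inter_eval (σ : Strategy S) (n : ℕ) {B : Set (Fin n → S)}
    (hB : MeasurableSet B) {A : Set S} (hA : MeasurableSet A) :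
    σ.law (initial S n ⁻¹' B ∩ (fun x => x n) ⁻¹' A)
      = ∫⁻ x, B.indicator (fun z => σ.pred n z A) (initial S n x) ∂σ.law := by
  have hm := measurable_initial (S := S) n
  have h := lintegral_initial_eval σ n (f := (B ×ˢ A).indicator (1 : (Fin n → S) × S → ENNReal))
    (measurable_one.indicator (hB.prod hA))
  have e : ∀ x : ℕ → S, (B ×ˢ A).indicator (1 : (Fin n → S) × S → ENNReal) (initial S n x, x n)
      = (initial S n ⁻¹' B ∩ (fun x => x n) ⁻¹' A).indicator 1 x := fun x => rfl
  simp_rw [e] at h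
  rw [lintegral_indicator_one ((hm hB).inter (measurable_pi_apply n hA))] at h
  rw [h]
  refine lintegral_congr fun x => ?_
  by_cases hx : initial S n x ∈ B
  · have e' : ∀ y, (B ×ˢ A).indicator (1 : (Fin n → S) × S → ENNReal) (initial S n x, y) = A.indicator 1 y := by
      intro y
      by_cases hy : y ∈ A <;> simp [hx, hy]
    simp_rw [e', Set.indicator_of_mem hx, lintegral_indicator_one hA]
  · have e' : ∀ y, (B ×ˢ A).indicator (1 : (Fin n → S) × S → ENNReal) (initial S n x, y) = 0 := by
      intro y
      simp [hx]
    simp_rw [e', Set.indicator_of_notMem hx, lintegral_zero]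

/-- Membership in `B` ignores the coordinate `x n`, so that coordinate can be integrated out under
`σ_n`, where consistency turns `σ_{n+1}` into `σ_n`. -/
theorem IsConsistent.law_inter_eval_succ {σ : Strategy S} (hσ : σ.IsConsistent) (n : ℕ)
    {B : Set (Fin n → S)} (hB : MeasurableSet B) {A : Set S} (hA : MeasurableSet A) :
    σ.law (initial S n ⁻¹' B ∩ (fun x => x (n + 1)) ⁻¹' A)
      = σ.law (initial S n ⁻¹' B ∩ (fun x => x n) ⁻¹' A) := by
  let B' : Set (Fin (n + 1) → S) := (fun z i => z (Fin.castSucc i)) ⁻¹' B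
  have hB' : MeasurableSet B' :=
    (measurable_pi_lambda _ fun _ => measurable_pi_apply _) hB
  have hsnoc : Measurable fun p : (Fin n → S) × S => Fin.snoc (α := fun _ => S) p.1 p.2 := by
    refine measurable_pi_lambda _ fun i => ?_
    refine Fin.lastCases ?_ (fun j => ?_) i
    · simpa using measurable_snd
    · simp only [Fin.snoc_castSucc]
      fun_prop
  have hinit : ∀ x : ℕ → S,
      initial S (n + 1) x = Fin.snoc (α := fun _ => S) (initial S n x) (x n) := by
    intro x
    ext i
    refine Fin.lastCases ?_ (fun j => ?_) i <;> simp [initial]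
  have hF : Measurable (B'.indicator fun z => σ.pred (n + 1) z A) :=
    (Kernel.measurable_coe _ hA).indicator hB'
  have h1 := law_initial_inter_eval σ (n + 1) hB' hA
  rw [show initial S (n + 1) ⁻¹' B' = initial S n ⁻¹' B from rfl] at h1
  rw [h1, law_initial_inter_eval σ n hB hA]
  simp_rw [hinit]
  refine (lintegral_initial_eval σ n (hF.comp hsnoc)).trans (lintegral_congr fun x => ?_)
  have hmem : ∀ y, Fin.snoc (α := fun _ => S) (initial S n x) y ∈ B' ↔ initial S n x ∈ B := by
    intro y
    simp [B']
  by_cases hx : initial S n x ∈ B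
  · rw [Set.indicator_of_mem hx, ← hσ n _ A hA]
    exact lintegral_congr fun y => Set.indicator_of_mem ((hmem y).2 hx) _
  · rw [Set.indicator_of_notMem hx]
    exact (lintegral_congr fun y =>
      Set.indicator_of_notMem (fun h => hx ((hmem y).1 h)) _).trans lintegral_zero

theorem IsConsistent.law_inter_eval {σ : Strategy S} (hσ : σ.IsConsistent) {n k : ℕ}
    (hnk : n ≤ k) {B : Set (Fin n → S)} (hB : MeasurableSet B) {A : Set S}
    (hA : MeasurableSet A) :
    σ.law (initial S n ⁻¹' B ∩ (fun x => x k) ⁻¹' A)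
      = σ.law (initial S n ⁻¹' B ∩ (fun x => x n) ⁻¹' A) := by
  induction k, hnk using Nat.le_induction with
  | base => rfl
  | succ k hk ih =>
    rw [← ih]
    exact hσ.law_inter_eval_succ k (B := (fun z i => z (Fin.castLE hk i)) ⁻¹' B)
      ((measurable_pi_lambda _ fun _ => measurable_pi_apply _) hB) hA

/-- A strategy with consistent predictives makes the coordinates conditionally identically
distributed. -/
theorem IsConsistent.isCID {σ : Strategy S} (hσ : σ.IsConsistent) : IsCID σ.law := by
  intro n k hnk A hA
  have hle : pastSigma S n ≤ MeasurableSpace.pi := (measurable_initial n).comap_le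
  have hk : ∀ j, MeasurableSet ((fun x : ℕ → S => x j) ⁻¹' A) :=
    fun j => measurable_pi_apply j hA
  have hint : ∀ j, Integrable (((fun x : ℕ → S => x j) ⁻¹' A).indicator fun _ => (1 : ℝ))
      σ.law := fun j => (integrable_const _).indicator (hk j)
  symm
  -- The conditional probability for coordinate `n` is tested as a candidate for the one for
  -- coordinate `k`.
  refine ae_eq_condExp_of_forall_setIntegral_eq hle (hint k)
    (fun _ _ _ => integrable_condExp.integrableOn) ?_ stronglyMeasurable_condExp.aestronglyMeasurable
  rintro s hs -
  rw [setIntegral_condExp hle (hint n) hs]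
  obtain ⟨B, hB, rfl⟩ := hs
  have h := hσ.law_inter_eval hnk hB hA
  rw [setIntegral_indicator (hk n), setIntegral_indicator (hk k), setIntegral_const,
    setIntegral_const, measureReal_def, measureReal_def]
  congr 2
  exact h.symm

end Strategy

/-! ### Stable laws and consistency of their predictives -/

namespace StablePrediction

variable {Ω : Type*} [MeasurableSpace Ω] {μ : Measure Ω} {Z : Ω → ℝ}

/-- Since `|b^(1/γ) t|^γ = b |t|^γ`, the scale `b` enters the exponent linearly; this is why scales
add under convolution. -/
theorem charFun_stableLaw {γ : ℝ} (hγ : 0 < γ) (hZ : Measurable Z)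
    (hchar : ∀ t : ℝ, charFun (μ.map Z) t = ((Real.exp (-(|t| ^ γ / 2)) : ℝ) : ℂ))
    (a : ℝ) {b : ℝ} (hb : 0 ≤ b) (t : ℝ) :
    charFun (stableLaw μ Z γ a b) t
      = Complex.exp (t * a * Complex.I) * (Real.exp (-(b * |t| ^ γ / 2)) : ℝ) := by
  have h : stableLaw μ Z γ a b
      = ((μ.map Z).map (fun z => b ^ (1 / γ) * z)).map (fun z => z + a) := by
    rw [Measure.map_map (by fun_prop) (by fun_prop), Measure.map_map (by fun_prop) (by fun_prop)]
    refine congrArg (μ.map ·) ?_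
    ext ω
    simp [add_comm]
  rw [h, charFun_map_add_const, charFun_map_mul, hchar, abs_mul,
    Real.mul_rpow (abs_nonneg _) (abs_nonneg _), abs_of_nonneg (Real.rpow_nonneg hb _),
    ← Real.rpow_mul hb, one_div_mul_cancel hγ.ne', Real.rpow_one, mul_comm]
  congr 2
  simp [mul_comm]

/-- Stability: a sum of independent stable variables is stable, with scales added. -/
theorem stableLaw_conv [IsProbabilityMeasure μ] {γ : ℝ} (hγ : 0 < γ) (hZ : Measurable Z)
    (hchar : ∀ t : ℝ, charFun (μ.map Z) t = ((Real.exp (-(|t| ^ γ / 2)) : ℝ) : ℂ))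
    (a : ℝ) {b b' : ℝ} (hb : 0 ≤ b) (hb' : 0 ≤ b') :
    stableLaw μ Z γ a b ∗ stableLaw μ Z γ 0 b' = stableLaw μ Z γ a (b + b') := by
  have hp : ∀ a b, IsProbabilityMeasure (stableLaw μ Z γ a b) := fun a b =>
    Measure.isProbabilityMeasure_map (by fun_prop)
  have := hp a b
  have := hp 0 b'
  have := hp a (b + b')
  refine Measure.ext_of_charFun (funext fun t => ?_)
  rw [charFun_conv, charFun_stableLaw hγ hZ hchar a hb, charFun_stableLaw hγ hZ hchar 0 hb',
    charFun_stableLaw hγ hZ hchar a (add_nonneg hb hb')]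
  push_cast
  rw [← Complex.exp_add, ← Complex.exp_add, ← Complex.exp_add, ← Complex.exp_add]
  congr 1
  ring

theorem stableStrategy_isConsistent [IsProbabilityMeasure μ] {γ : ℝ} (hγ : 0 < γ) (hZ : Measurable Z)
    (hchar : ∀ t : ℝ, charFun (μ.map Z) t = ((Real.exp (-(|t| ^ γ / 2)) : ℝ) : ℂ))
    {u : ℝ} {us : ℕ → ℝ} (husmono : StrictMono us) (husu : ∀ n, us n < u) :
    (stableStrategy μ Z hZ γ u us).IsConsistent := by
  intro n x A hA
  change ∫⁻ y, stableLaw μ Z γ (loc γ u us (n + 1) (Fin.snoc (α := fun _ => ℝ) x y))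
    (u - us (n + 1)) A ∂stableLaw μ Z γ (loc γ u us n x) (u - us n)
      = stableLaw μ Z γ (loc γ u us n x) (u - us n) A
  set l := loc γ u us n x
  have hd : 0 ≤ us (n + 1) - us n := (sub_pos.2 (husmono n.lt_succ_self)).le
  have hb : 0 < u - us n := sub_pos.2 (husu n)
  have hb' : 0 < u - us (n + 1) := sub_pos.2 (husu _)
  have hc : ((us (n + 1) - us n) / (u - us n)) ^ (1 / γ) * (u - us n) ^ (1 / γ)
      = (us (n + 1) - us n) ^ (1 / γ) := by
    rw [← Real.mul_rpow (div_nonneg hd hb.le) hb.le, div_mul_cancel₀ _ hb.ne']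
  have hloc : ∀ y, loc γ u us (n + 1) (Fin.snoc (α := fun _ => ℝ) x y)
      = l * (1 - ((us (n + 1) - us n) / (u - us n)) ^ (1 / γ))
        + y * ((us (n + 1) - us n) / (u - us n)) ^ (1 / γ) := by
    intro y
    simp [loc, l]
  have hmeas : ∀ b, Measurable fun a => stableLaw μ Z γ a b A := fun b =>
    (Measure.measurable_coe hA).comp (measurable_stableLaw μ Z hZ γ b)
  have hshift : ∀ a b, stableLaw μ Z γ a b = (stableLaw μ Z γ 0 b).map (a + ·) := by
    intro a b
    unfold stableLaw
    rw [Measure.map_map (by fun_prop) (by fun_prop)]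
    refine congrArg (μ.map ·) ?_
    ext ω
    simp
  have hp : IsProbabilityMeasure (stableLaw μ Z γ 0 (u - us (n + 1))) :=
    Measure.isProbabilityMeasure_map (by fun_prop)
  have hconv := stableLaw_conv hγ hZ hchar l hd hb'.le
  rw [show us (n + 1) - us n + (u - us (n + 1)) = u - us n by ring] at hconv
  conv_rhs => rw [← hconv]
  rw [Measure.conv, Measure.map_apply (by fun_prop) hA,
    Measure.prod_apply (measurable_add hA)]
  have hfib : ∀ a, stableLaw μ Z γ 0 (u - us (n + 1))
      (Prod.mk a ⁻¹' ((fun p : ℝ × ℝ => p.1 + p.2) ⁻¹' A))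
        = stableLaw μ Z γ a (u - us (n + 1)) A := by
    intro a
    rw [hshift a, Measure.map_apply (by fun_prop) hA]
    rfl
  simp_rw [hfib, hloc]
  -- Only the integrating measures need unfolding, to bring both integrals back to `Ω`; the `change`
  -- refolds the integrands.
  conv_lhs => unfold stableLaw
  conv_rhs => unfold stableLaw
  change ∫⁻ y, stableLaw μ Z γ _ (u - us (n + 1)) A ∂_
    = ∫⁻ a, stableLaw μ Z γ a (u - us (n + 1)) A ∂_
  rw [lintegral_map (by exact (hmeas _).comp (by fun_prop)) (by fun_prop),
    lintegral_map (hmeas _) (by fun_prop)]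
  refine lintegral_congr fun ω => ?_
  -- What remains is equality of locations, where `hc` cancels the factor `(u - u_n)^(1/γ)`.
  congr 2
  rw [← hc]
  ring

end StablePrediction

theorem mainTheorem2 {Ω : Type*} [MeasurableSpace Ω] (μ : Measure Ω) [IsProbabilityMeasure μ]
    (γ : ℝ) (hγ0 : 0 < γ) (hγ2 : γ ≤ 2)
    (Z : Ω → ℝ) (hZ : Measurable Z)
    (hchar : ∀ t : ℝ, charFun (μ.map Z) t = ((Real.exp (-(|t| ^ γ / 2)) : ℝ) : ℂ))
    (u : ℝ) (us : ℕ → ℝ) (hus0 : us 0 = 0) (husmono : StrictMono us) (husu : ∀ n, us n < u) :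
    IsCID (StablePrediction.stableStrategy μ Z hZ γ u us).law :=
  (StablePrediction.stableStrategy_isConsistent hγ0 hZ hchar husmono husu).isCID
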